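/- Let $\alpha,\gamma,\nu,\rho,\sigma,\omega\in\mathbb{R}$ with $\alpha>0$, $\nu>0$, $\rho>0$. Let $\Omega=[a,b]\subseteq\mathbb{R}$, $-\infty\le a<b\le\infty$, be a finite or infinite closed interval (infinite end points are not part of $\Omega$), and let $\psi:\Omega\to\mathbb{R}$ be increasing and differentiable with $\psi'(x)\neq 0$ for all $x\in\Omega$. Write $$E_{\rho,\alpha}^{\gamma}(z)=\sum_{k=0}^{\infty}\frac{(\gamma)_k}{\Gamma(\rho k+\alpha)}\frac{z^k}{k!},\qquad (\gamma)_0=1,\quad (\gamma)_k=\gamma(\gamma+1)\cdots(\gamma+k-1),$$ and, for $x\in\Omega$, $$\mathbb{E}_{\rho,\alpha,\omega;a+}^{\gamma;\psi}f(x)=\int_{a}^{x}\psi'(t)\,(\psi(x)-\psi(t))^{\alpha-1}E_{\rho,\alpha}^{\gamma}[\omega(\psi(x)-\psi(t))^{\rho}]\,f(t)\,dt,$$ $$\mathbb{E}_{\rho,\alpha,\omega;b-}^{\gamma;\psi}f(x)=\int_{x}^{b}\psi'(t)\,(\psi(t)-\psi(x))^{\alpha-1}E_{\rho,\alpha}^{\gamma}[\omega(\psi(t)-\psi(x))^{\rho}]\,f(t)\,dt,$$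 where convergence means absolute convergence of these Lebesgue integrals. Left-sided operators. Suppose that $\psi$ is bounded below on $\Omega$ (automatic if $a>-\infty$) and that $f:\Omega\to\mathbb{R}$ is such that $\psi' f$ is integrable on $[a,x]$ for every $x\in\Omega$ (for $a>-\infty$ and $\psi\in C^1(\Omega)$ this holds whenever $f$ is integrable on $\Omega$). Then for almost every $x\in\Omega$ the integrals defining $\mathbb{E}_{\rho,\alpha,\omega;a+}^{\gamma;\psi}f(x)$, $\mathbb{E}_{\rho,\nu,\omega;a+}^{\sigma;\psi}f(x)$ and $\mathbb{E}_{\rho,\alpha+\nu,\omega;a+}^{\gamma+\sigma;\psi}f(x)$ converge, and for every $x\in\Omega$ at which the last of these converges, the outer integrals of both compositions below converge at $x$ and $$\mathbb{E}_{\rho,\alpha,\omega;a+}^{\gamma;\psi}\mathbb{E}_{\rho,\nu,\omega;a+}^{\sigma;\psi}f(x)=\mathbb{E}_{\rho,\alpha+\nu,\omega;a+}^{\gamma+\sigma;\psi}f(x)=\mathbb{E}_{\rho,\nu,\omega;a+}^{\sigma;\psi}\mathbb{E}_{\rho,\alpha,\omega;a+}^{\gamma;\psi}f(x).$$ Right-sided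 operators. Suppose that $\psi$ is bounded above on $\Omega$ (automatic if $b<\infty$) and that $f:\Omega\to\mathbb{R}$ is such that $\psi' f$ is integrable on $[x,b]$ for every $x\in\Omega$. Then for almost every $x\in\Omega$ the integrals defining $\mathbb{E}_{\rho,\alpha,\omega;b-}^{\gamma;\psi}f(x)$, $\mathbb{E}_{\rho,\nu,\omega;b-}^{\sigma;\psi}f(x)$ and $\mathbb{E}_{\rho,\alpha+\nu,\omega;b-}^{\gamma+\sigma;\psi}f(x)$ converge, and for every $x\in\Omega$ at which the last of these converges, the outer integrals of both compositions below converge at $x$ and $$\mathbb{E}_{\rho,\alpha,\omega;b-}^{\gamma;\psi}\mathbb{E}_{\rho,\nu,\omega;b-}^{\sigma;\psi}f(x)=\mathbb{E}_{\rho,\alpha+\nu,\omega;b-}^{\gamma+\sigma;\psi}f(x)=\mathbb{E}_{\rho,\nu,\omega;b-}^{\sigma;\psi}\mathbb{E}_{\rho,\alpha,\omega;b-}^{\gamma;\psi}f(x).$$ (At a point where an inner operator's integral diverges, which is a null set, its value is immaterial.) -/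

import Mathlib

open MeasureTheory

/-- The three-parameter Mittag-Leffler (Prabhakar) function
`E_{ρ,α}^γ(z) = ∑_{k ≥ 0} (γ)_k / Γ(ρ k + α) * z ^ k / k!`,
with `(γ)_k = γ (γ + 1) ⋯ (γ + k - 1)`. -/
noncomputable def mittagLeffler (ρ α γ z : ℝ) : ℝ :=
  ∑' k : ℕ, (ascPochhammer ℝ k).eval γ / Real.Gamma (ρ * k + α) * (z ^ k / (k.factorial : ℝ))

/-- The closed real interval `[a, b]` with possibly infinite end points. -/
def closedInterval (a b : EReal) : Set ℝ :=
  {t : ℝ | a ≤ (t : EReal) ∧ (t : EReal) ≤ b}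

/-- The integrand of the left-sided operator at the point `x`, as a function of `t`:
`ψ'(t) (ψ(x) - ψ(t))^(α-1) E_{ρ,α}^γ[ω (ψ(x) - ψ(t))^ρ] f(t)`. -/
noncomputable def leftIntegrand (ρ α ω γ : ℝ) (ψ f : ℝ → ℝ) (x t : ℝ) : ℝ :=
  deriv ψ t * (ψ x - ψ t) ^ (α - 1) * mittagLeffler ρ α γ (ω * (ψ x - ψ t) ^ ρ) * f t

/-- The integrand of the right-sided operator at the point `x`, as a function of `t`:
`ψ'(t) (ψ(t) - ψ(x))^(α-1) E_{ρ,α}^γ[ω (ψ(t) - ψ(x))^ρ] f(t)`. -/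
noncomputable def rightIntegrand (ρ α ω γ : ℝ) (ψ f : ℝ → ℝ) (x t : ℝ) : ℝ :=
  deriv ψ t * (ψ t - ψ x) ^ (α - 1) * mittagLeffler ρ α γ (ω * (ψ t - ψ x) ^ ρ) * f t

/-- The integral over `[a, x]` defining the left-sided operator converges absolutely at `x`. -/
def LeftConverges (ρ α ω γ : ℝ) (ψ : ℝ → ℝ) (a : EReal) (f : ℝ → ℝ) (x : ℝ) : Prop :=
  IntegrableOn (leftIntegrand ρ α ω γ ψ f x) (closedInterval a (x : EReal)) volume

/-- The integral over `[x, b]` defining the right-sided operator converges absolutely at `x`. -/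
def RightConverges (ρ α ω γ : ℝ) (ψ : ℝ → ℝ) (b : EReal) (f : ℝ → ℝ) (x : ℝ) : Prop :=
  IntegrableOn (rightIntegrand ρ α ω γ ψ f x) (closedInterval (x : EReal) b) volume

/-- The left-sided fractional integral operator `𝔼^{γ;ψ}_{ρ,α,ω;a+}`. -/
noncomputable def leftOp (ρ α ω γ : ℝ) (ψ : ℝ → ℝ) (a : EReal) (f : ℝ → ℝ) (x : ℝ) : ℝ :=
  ∫ t in closedInterval a (x : EReal), leftIntegrand ρ α ω γ ψ f x t

/-- The right-sided fractional integral operator `𝔼^{γ;ψ}_{ρ,α,ω;b-}`. -/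
noncomputable def rightOp (ρ α ω γ : ℝ) (ψ : ℝ → ℝ) (b : EReal) (f : ℝ → ℝ) (x : ℝ) : ℝ :=
  ∫ t in closedInterval (x : EReal) b, rightIntegrand ρ α ω γ ψ f x t

/-! Put `w = ψ' f` and `k(u) = u ^ (α - 1) E_{ρ,α}^γ(ω u ^ ρ)`. The left-sided operator is `∫ k(ψ x
- ψ s) w(s) ds`, a convolution in the variable `ψ`. The theorem therefore splits into an identity
for kernels (`integral_mlKernel_mul`) and an interchange of integrals
(`integrable_and_integral_comp`).

Identity: `k(u)` is the sum over `n` of `(γ)_n / n! * ω ^ n` times the Riemann-Liouville kernel of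
order `ρ n + α`. The Riemann-Liouville kernels `u ^ (p - 1) / Γ(p)` are a convolution semigroup in
`p` by the beta integral, and the coefficients, being those of `(1 - z) ^ (-γ)`, multiply by the
Vandermonde convolution `sum_antidiagonal_risingCoeff_mul`.

Interchange: since `ψ` is bounded below, only a bounded range of `u` occurs, and there `|k(u)| ≤ C u
^ (α - 1)`. Fubini thus needs only `∫ (ψ x - ψ s) ^ (α + ν - 1) |w(s)| ds < ∞`. Convergence of the
third operator at `x` gives this even though its Mittag-Leffler factor may vanish: that factor is
nonzero at `u = 0`, and away from `0` the power is bounded while `w` is integrable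
(`exists_rpow_le_mlKernel`). Almost everywhere convergence is the same Fubini argument with outer
kernel `1`.

The right-sided case is the left-sided one for `-ψ(-t)` and `f(-t)` on `[-b, -a]`. -/

open Set Filter Topology

/-! ### Binomial series coefficients. -/

/-- The coefficient `(γ)_k / k!` of the binomial series of `(1 - z) ^ (-γ)`. -/
noncomputable def risingCoeff (γ : ℝ) (k : ℕ) : ℝ :=
  (ascPochhammer ℝ k).eval γ / (k.factorial : ℝ)

lemma risingCoeff_zero (γ : ℝ) : risingCoeff γ 0 = 1 := by
  simp [risingCoeff]

lemma risingCoeff_succ (γ : ℝ) (k : ℕ) :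
    ((k : ℝ) + 1) * risingCoeff γ (k + 1) = (γ + k) * risingCoeff γ k := by
  have h : (k.factorial : ℝ) ≠ 0 := by positivity
  have h' : (k : ℝ) + 1 ≠ 0 := by positivity
  simp only [risingCoeff, ascPochhammer_succ_eval, Nat.factorial_succ]
  push_cast
  field_simp

lemma abs_risingCoeff_le (γ : ℝ) (k : ℕ) : |risingCoeff γ k| ≤ (|γ| + 1) ^ k := by
  induction k with
  | zero => simp [risingCoeff_zero]
  | succ k ih =>
    have h' : (0 : ℝ) < (k : ℝ) + 1 := by positivity
    have h : risingCoeff γ (k + 1) = (γ + k) / (k + 1) * risingCoeff γ k := by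
      rw [div_mul_eq_mul_div, ← risingCoeff_succ]
      field_simp
    rw [h, abs_mul, pow_succ']
    refine mul_le_mul ?_ ih (abs_nonneg _) (by positivity)
    rw [abs_div, abs_of_pos h', div_le_iff₀ h']
    calc |γ + k| ≤ |γ| + |(k : ℝ)| := abs_add_le _ _
      _ = |γ| + k := by rw [Nat.abs_cast]
      _ ≤ (|γ| + 1) * (k + 1) := by
        have : 0 ≤ |γ| * k := by positivity
        nlinarith

/-- This compares coefficients in `(1 - z) ^ (-γ) * (1 - z) ^ (-σ)`. In the induction the factor `n
+ 1` is split as `i + j`; each half lowers one index by `risingCoeff_succ`, and `(γ + i) + (σ + j) =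
γ + σ + n`. -/
lemma sum_antidiagonal_risingCoeff_mul (γ σ : ℝ) (n : ℕ) :
    ∑ p ∈ Finset.HasAntidiagonal.antidiagonal n, risingCoeff γ p.1 * risingCoeff σ p.2 =
      risingCoeff (γ + σ) n := by
  induction n with
  | zero => simp [risingCoeff_zero]
  | succ n ih =>
    have hn : (n : ℝ) + 1 ≠ 0 := by positivity
    refine mul_left_cancel₀ hn ?_
    rw [risingCoeff_succ, ← ih, Finset.mul_sum, Finset.mul_sum]
    have h1 : ∑ p ∈ Finset.HasAntidiagonal.antidiagonal (n + 1),
        ((n : ℝ) + 1) * (risingCoeff γ p.1 * risingCoeff σ p.2) =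
        ∑ p ∈ Finset.HasAntidiagonal.antidiagonal (n + 1), (p.1 : ℝ) * (risingCoeff γ p.1 * risingCoeff σ p.2) +
        ∑ p ∈ Finset.HasAntidiagonal.antidiagonal (n + 1),
          (p.2 : ℝ) * (risingCoeff γ p.1 * risingCoeff σ p.2) := by
      rw [← Finset.sum_add_distrib]
      refine Finset.sum_congr rfl fun p hp => ?_
      rw [← add_mul]
      have : p.1 + p.2 = n + 1 := Finset.HasAntidiagonal.mem_antidiagonal.1 hp
      have : (p.1 : ℝ) + p.2 = n + 1 := by exact_mod_cast this
      rw [this]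
    rw [h1, Finset.Nat.sum_antidiagonal_succ, Finset.Nat.sum_antidiagonal_succ']
    simp only [Nat.cast_zero, zero_mul, zero_add]
    rw [← Finset.sum_add_distrib]
    refine Finset.sum_congr rfl fun p hp => ?_
    have : p.1 + p.2 = n := Finset.HasAntidiagonal.mem_antidiagonal.1 hp
    have hp' : (p.1 : ℝ) + p.2 = n := by exact_mod_cast this
    push_cast
    rw [← mul_assoc, risingCoeff_succ, mul_left_comm, risingCoeff_succ, ← hp']
    ring

/-! ### Growth of Gamma and convergence of the Mittag-Leffler series. -/

/-- The Gamma function outgrows every exponential. -/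
lemma rpow_mul_exp_le_Gamma {A s : ℝ} (hA : 0 < A) (hs : 1 ≤ s) :
    A ^ (s - 1) * Real.exp (-(A + 1)) ≤ Real.Gamma s := by
  rw [Real.Gamma_eq_integral (by linarith)]
  have hint := Real.GammaIntegral_convergent (s := s) (by linarith)
  have hsub : Ioo A (A + 1) ⊆ Ioi 0 := fun t ht => hA.trans ht.1
  -- Only the window `(A, A + 1)` of length one is kept from the Gamma integral.
  calc A ^ (s - 1) * Real.exp (-(A + 1))
      = ∫ _ in Ioo A (A + 1), A ^ (s - 1) * Real.exp (-(A + 1)) := by simp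
    _ ≤ ∫ t in Ioo A (A + 1), Real.exp (-t) * t ^ (s - 1) := by
        refine setIntegral_mono_on (integrableOn_const (by simp)) (hint.mono_set hsub) measurableSet_Ioo fun t ht => ?_
        rw [mul_comm]
        have := ht.1
        have := ht.2
        gcongr
    _ ≤ ∫ t in Ioi 0, Real.exp (-t) * t ^ (s - 1) := by
        refine setIntegral_mono_set hint ?_ hsub.eventuallyLE
        refine (ae_restrict_iff' measurableSet_Ioi).2 (.of_forall fun t (ht : 0 < t) => ?_)
        simp only [Pi.zero_apply]
        positivity

lemma exists_inv_Gamma_le {ρ α r : ℝ} (hρ : 0 < ρ) (hα : 0 < α) (hr : 0 < r) :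
    ∃ C, 0 ≤ C ∧ ∀ n : ℕ, (Real.Gamma (ρ * n + α))⁻¹ ≤ C * r ^ n := by
  -- From `N` on, the Gamma argument is at least `1`, as `rpow_mul_exp_le_Gamma` requires; the
  -- finitely many earlier terms go into `C₂`. The choice `A ^ ρ = r⁻¹` below produces the rate `r`.
  obtain ⟨N, hN⟩ := exists_nat_gt (1 / ρ)
  have hN' : 1 ≤ ρ * N := by
    rw [div_lt_iff₀ hρ] at hN
    linarith
  set A : ℝ := r⁻¹ ^ ρ⁻¹ with hA_def
  have hA : 0 < A := by positivity
  have hAr (n : ℕ) : A ^ (ρ * n) = (r ^ n)⁻¹ := by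
    rw [hA_def, ← Real.rpow_mul (by positivity), ← mul_assoc, inv_mul_cancel₀ hρ.ne', one_mul,
      Real.rpow_natCast, inv_pow]
  set C₁ : ℝ := (A ^ (α - 1) * Real.exp (-(A + 1)))⁻¹ with hC₁
  have hpos (n : ℕ) : 0 < Real.Gamma (ρ * n + α) := Real.Gamma_pos_of_pos (by positivity)
  set C₂ : ℝ := ∑ n ∈ Finset.range N, (Real.Gamma (ρ * n + α))⁻¹ / r ^ n with hC₂
  have hC₁0 : 0 ≤ C₁ := by positivity
  have hC₂0 : 0 ≤ C₂ := Finset.sum_nonneg fun n _ => by have := hpos n; positivity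
  refine ⟨C₁ + C₂, by positivity, fun n => ?_⟩
  rcases lt_or_ge n N with h | h
  · have h1 : (Real.Gamma (ρ * n + α))⁻¹ / r ^ n ≤ C₂ :=
      Finset.single_le_sum (f := fun n : ℕ => (Real.Gamma (ρ * n + α))⁻¹ / r ^ n)
        (fun n _ => by have := hpos n; positivity) (Finset.mem_range.2 h)
    rw [div_le_iff₀ (by positivity)] at h1
    refine h1.trans ?_
    gcongr
    linarith
  · have h0 : (N : ℝ) ≤ n := by exact_mod_cast h
    have h1 : 1 ≤ ρ * n + α := by nlinarith
    have h2 := rpow_mul_exp_le_Gamma hA h1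
    have h3 : (Real.Gamma (ρ * n + α))⁻¹ ≤ C₁ * r ^ n := by
      calc (Real.Gamma (ρ * n + α))⁻¹
          ≤ (A ^ (ρ * n + α - 1) * Real.exp (-(A + 1)))⁻¹ := by gcongr
        _ = C₁ * r ^ n := by
          rw [add_sub_assoc, Real.rpow_add hA, hAr, hC₁]
          simp only [mul_inv, inv_inv]
          ring
    refine h3.trans ?_
    gcongr
    linarith

/-- The `k`-th coefficient of the power series of the Mittag-Leffler function. -/
noncomputable def mlCoeff (ρ α γ : ℝ) (k : ℕ) : ℝ :=
  risingCoeff γ k / Real.Gamma (ρ * k + α)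

lemma mittagLeffler_eq_tsum (ρ α γ z : ℝ) :
    mittagLeffler ρ α γ z = ∑' k : ℕ, mlCoeff ρ α γ k * z ^ k := by
  refine tsum_congr fun k => ?_
  simp only [mlCoeff, risingCoeff]
  ring

lemma summable_geometric_div_Gamma {ρ α M : ℝ} (hρ : 0 < ρ) (hα : 0 < α) (hM : 0 < M) :
    Summable fun n : ℕ => M ^ n / Real.Gamma (ρ * n + α) := by
  -- The rate `1 / (2 M)` leaves a geometric series of ratio `1 / 2`.
  obtain ⟨C, -, hC⟩ := exists_inv_Gamma_le hρ hα (r := (2 * M)⁻¹) (by positivity)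
  have hpos (n : ℕ) : 0 < Real.Gamma (ρ * n + α) := Real.Gamma_pos_of_pos (by positivity)
  refine Summable.of_nonneg_of_le (fun n => by have := hpos n; positivity) (fun n => ?_)
    ((summable_geometric_two).mul_left C)
  calc M ^ n / Real.Gamma (ρ * n + α) ≤ M ^ n * (C * (2 * M)⁻¹ ^ n) := by
        rw [div_eq_mul_inv]
        gcongr
        exact hC n
    _ = C * (1 / 2) ^ n := by
        rw [mul_left_comm, ← mul_pow]
        congr 2
        field_simp

lemma summable_geometric_div_Gamma_prod {ρ α M : ℝ} (hρ : 0 < ρ) (hα : 0 < α) (hM : 0 < M) :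
    Summable fun n : ℕ × ℕ => M ^ (n.1 + n.2) / Real.Gamma (ρ * (n.1 + n.2) + α) := by
  obtain ⟨C, -, hC⟩ := exists_inv_Gamma_le hρ hα (r := (2 * M)⁻¹) (by positivity)
  have hpos (n m : ℕ) : 0 < Real.Gamma (ρ * (n + m) + α) := Real.Gamma_pos_of_pos (by positivity)
  have hg := ((summable_geometric_two).mul_of_nonneg (summable_geometric_two)
    (fun n => by positivity) (fun n => by positivity)).mul_left C
  refine Summable.of_nonneg_of_le (fun n => by have := hpos n.1 n.2; positivity) (fun n => ?_) hg
  have h := hC (n.1 + n.2)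
  push_cast at h
  calc M ^ (n.1 + n.2) / Real.Gamma (ρ * (n.1 + n.2) + α)
      ≤ M ^ (n.1 + n.2) * (C * (2 * M)⁻¹ ^ (n.1 + n.2)) := by
        rw [div_eq_mul_inv]
        gcongr
    _ = C * ((1 / 2) ^ n.1 * (1 / 2) ^ n.2) := by
        rw [mul_left_comm, ← mul_pow, ← pow_add]
        congr 2
        field_simp

lemma norm_mlCoeff_mul_pow_le {ρ α γ z R : ℝ} (hρ : 0 < ρ) (hα : 0 < α) (hz : |z| ≤ R) (k : ℕ) :
    ‖mlCoeff ρ α γ k * z ^ k‖ ≤ ((|γ| + 1) * R) ^ k / Real.Gamma (ρ * k + α) := by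
  have hpos : 0 < Real.Gamma (ρ * k + α) := Real.Gamma_pos_of_pos (by positivity)
  rw [Real.norm_eq_abs, abs_mul, mlCoeff, abs_div, abs_of_pos hpos, abs_pow, div_mul_eq_mul_div,
    mul_pow]
  gcongr
  exact abs_risingCoeff_le γ k

lemma summable_mlCoeff_mul_pow {ρ α : ℝ} (hρ : 0 < ρ) (hα : 0 < α) (γ z : ℝ) :
    Summable fun k : ℕ => mlCoeff ρ α γ k * z ^ k :=
  Summable.of_norm_bounded (summable_geometric_div_Gamma hρ hα (by positivity))
    (norm_mlCoeff_mul_pow_le hρ hα (le_add_of_nonneg_right zero_le_one : |z| ≤ |z| + 1))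

lemma continuous_mittagLeffler {ρ α : ℝ} (hρ : 0 < ρ) (hα : 0 < α) (γ : ℝ) :
    Continuous (mittagLeffler ρ α γ) := by
  rw [continuous_iff_continuousAt]
  intro z
  have hz : Metric.ball (0 : ℝ) (|z| + 1) ∈ 𝓝 z :=
    Metric.isOpen_ball.mem_nhds (by simp)
  refine ContinuousOn.continuousAt ?_ hz
  have : mittagLeffler ρ α γ = fun z => ∑' k : ℕ, mlCoeff ρ α γ k * z ^ k :=
    funext (mittagLeffler_eq_tsum ρ α γ)
  rw [this]
  refine continuousOn_tsum (fun k => by fun_prop)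
    (summable_geometric_div_Gamma hρ hα (M := (|γ| + 1) * (|z| + 1)) (by positivity))
    fun k y hy => norm_mlCoeff_mul_pow_le hρ hα ?_ k
  simpa using (mem_ball_zero_iff.1 hy).le

lemma mittagLeffler_zero (ρ α γ : ℝ) : mittagLeffler ρ α γ 0 = (Real.Gamma α)⁻¹ := by
  rw [mittagLeffler_eq_tsum, tsum_eq_single 0 fun k hk => by simp [hk]]
  simp [mlCoeff, risingCoeff_zero]

/-! ### Riemann-Liouville kernels and the beta integral. -/

/-- The kernel `u ^ (p - 1) / Γ(p)` of the Riemann-Liouville integral of order `p`. -/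
noncomputable def rlKernel (p u : ℝ) : ℝ := u ^ (p - 1) / Real.Gamma p

lemma rlKernel_nonneg {p u : ℝ} (hp : 0 < p) (hu : 0 ≤ u) : 0 ≤ rlKernel p u :=
  div_nonneg (Real.rpow_nonneg hu _) (Real.Gamma_pos_of_pos hp).le

lemma integrableOn_and_integral_rpow_mul_rpow {p q u : ℝ} (hp : 0 < p) (hq : 0 < q) (hu : 0 < u) :
    IntegrableOn (fun v => (u - v) ^ (p - 1) * v ^ (q - 1)) (Ioo 0 u) ∧
      ∫ v in Ioo 0 u, (u - v) ^ (p - 1) * v ^ (q - 1) =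
        u ^ (p + q - 1) * (Real.Gamma p * Real.Gamma q / Real.Gamma (p + q)) := by
  have hG : 0 < Real.Gamma p * Real.Gamma q / Real.Gamma (p + q) :=
    div_pos (mul_pos (Real.Gamma_pos_of_pos hp) (Real.Gamma_pos_of_pos hq))
      (Real.Gamma_pos_of_pos (by positivity))
  have h2 : ∫ v in Ioo 0 u, (u - v) ^ (p - 1) * v ^ (q - 1) =
        u ^ (p + q - 1) * (Real.Gamma p * Real.Gamma q / Real.Gamma (p + q)) := by
    have h := Complex.betaIntegral_scaled (q : ℂ) (p : ℂ) hu
    rw [Complex.betaIntegral_eq_Gamma_mul_div _ _ (by simpa) (by simpa),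
      intervalIntegral.integral_of_le hu.le, integral_Ioc_eq_integral_Ioo] at h
    have h3 : ∫ v in Ioo 0 u, ((v : ℂ) ^ ((q : ℂ) - 1) * ((u : ℂ) - v) ^ ((p : ℂ) - 1)) =
        ∫ v in Ioo 0 u, (((u - v) ^ (p - 1) * v ^ (q - 1) : ℝ) : ℂ) := by
      refine setIntegral_congr_fun measurableSet_Ioo fun v hv => ?_
      have h1 : 0 ≤ u - v := sub_nonneg.2 hv.2.le
      push_cast [Complex.ofReal_cpow h1, Complex.ofReal_cpow hv.1.le]
      ring
    rw [h3, integral_complex_ofReal] at h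
    have h4 : (u : ℂ) ^ ((q : ℂ) + p - 1) * (Complex.Gamma q * Complex.Gamma p /
        Complex.Gamma (q + p)) = ((u ^ (p + q - 1) *
          (Real.Gamma p * Real.Gamma q / Real.Gamma (p + q)) : ℝ) : ℂ) := by
      push_cast [Complex.ofReal_cpow hu.le, ← Complex.Gamma_ofReal]
      rw [add_comm (q : ℂ) p, mul_comm (Complex.Gamma q)]
    rw [h4] at h
    exact_mod_cast h
  refine ⟨?_, h2⟩
  -- The integral of a non-integrable function is `0` by convention, so a positive value forces
  -- integrability.
  by_contra hcon
  rw [integral_undef hcon] at h2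
  have : 0 < u ^ (p + q - 1) := by positivity
  exact absurd h2.symm (by positivity)

lemma integrableOn_rlKernel_mul {p q u : ℝ} (hp : 0 < p) (hq : 0 < q) (hu : 0 < u) :
    IntegrableOn (fun v => rlKernel p (u - v) * rlKernel q v) (Ioo 0 u) := by
  have h := (integrableOn_and_integral_rpow_mul_rpow hp hq hu).1.mul_const
    (Real.Gamma p * Real.Gamma q)⁻¹
  refine h.congr (.of_forall fun v => ?_)
  simp only [rlKernel, mul_inv]
  ring

lemma integral_rlKernel_mul {p q u : ℝ} (hp : 0 < p) (hq : 0 < q) (hu : 0 < u) :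
    ∫ v in Ioo 0 u, rlKernel p (u - v) * rlKernel q v = rlKernel (p + q) u := by
  have hGp := (Real.Gamma_pos_of_pos hp).ne'
  have hGq := (Real.Gamma_pos_of_pos hq).ne'
  have h : (fun v => rlKernel p (u - v) * rlKernel q v) =
      fun v => (u - v) ^ (p - 1) * v ^ (q - 1) * (Real.Gamma p * Real.Gamma q)⁻¹ := by
    funext v
    simp only [rlKernel, mul_inv]
    ring
  rw [h, integral_mul_const, (integrableOn_and_integral_rpow_mul_rpow hp hq hu).2, rlKernel]
  field_simp

/-! ### Prabhakar kernels: semigroup property and size. -/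

/-- The convolution kernel `u ^ (α - 1) E_{ρ,α}^γ(ω u ^ ρ)` of the Prabhakar operator. -/
noncomputable def mlKernel (ρ α ω γ u : ℝ) : ℝ :=
  u ^ (α - 1) * mittagLeffler ρ α γ (ω * u ^ ρ)

lemma hasSum_mlKernel {ρ α u : ℝ} (hρ : 0 < ρ) (hα : 0 < α) (ω γ : ℝ) (hu : 0 < u) :
    HasSum (fun k : ℕ => risingCoeff γ k * ω ^ k * rlKernel (ρ * k + α) u)
      (mlKernel ρ α ω γ u) := by
  have h := ((summable_mlCoeff_mul_pow hρ hα γ (ω * u ^ ρ)).hasSum).mul_left (u ^ (α - 1))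
  rw [← mittagLeffler_eq_tsum] at h
  refine h.congr_fun fun k => ?_
  rw [rlKernel, mlCoeff, mul_pow, add_sub_assoc, Real.rpow_add hu, Real.rpow_mul hu.le,
    Real.rpow_natCast]
  ring

/-- The kernels form a convolution semigroup. -/
lemma integral_mlKernel_mul {ρ α ν u : ℝ} (hρ : 0 < ρ) (hα : 0 < α) (hν : 0 < ν) (ω γ σ : ℝ)
    (hu : 0 < u) :
    ∫ v in Ioo 0 u, mlKernel ρ α ω γ (u - v) * mlKernel ρ ν ω σ v =
      mlKernel ρ (α + ν) ω (γ + σ) u := by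
  set A : ℕ → ℝ := fun k => risingCoeff γ k * ω ^ k with hA
  set B : ℕ → ℝ := fun k => risingCoeff σ k * ω ^ k with hB
  set F : ℕ × ℕ → ℝ → ℝ := fun n v => (A n.1 * B n.2) *
    (rlKernel (ρ * n.1 + α) (u - v) * rlKernel (ρ * n.2 + ν) v) with hF
  have hp (n : ℕ) : 0 < ρ * n + α := by positivity
  have hq (n : ℕ) : 0 < ρ * n + ν := by positivity
  have hsum (n : ℕ × ℕ) : ρ * n.1 + α + (ρ * n.2 + ν) = ρ * (n.1 + n.2) + (α + ν) := by ring
  have hFint (n : ℕ × ℕ) : Integrable (F n) (volume.restrict (Ioo 0 u)) :=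
    (integrableOn_rlKernel_mul (hp n.1) (hq n.2) hu).const_mul _
  have hFI (n : ℕ × ℕ) : ∫ v in Ioo 0 u, F n v =
      A n.1 * B n.2 * rlKernel (ρ * (n.1 + n.2) + (α + ν)) u := by
    rw [hF]
    simp only
    rw [integral_const_mul, integral_rlKernel_mul (hp n.1) (hq n.2) hu, hsum]
  have hFN (n : ℕ × ℕ) : ∫ v in Ioo 0 u, ‖F n v‖ =
      |A n.1 * B n.2| * rlKernel (ρ * (n.1 + n.2) + (α + ν)) u := by
    rw [← hsum, ← integral_rlKernel_mul (hp n.1) (hq n.2) hu, ← integral_const_mul]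
    refine setIntegral_congr_fun measurableSet_Ioo fun v hv => ?_
    simp only [hF]
    rw [norm_mul, Real.norm_eq_abs, Real.norm_of_nonneg]
    exact mul_nonneg (rlKernel_nonneg (hp _) (sub_nonneg.2 hv.2.le))
      (rlKernel_nonneg (hq _) hv.1.le)
  have hFS : Summable fun n => ∫ v in Ioo 0 u, ‖F n v‖ := by
    simp_rw [hFN]
    -- `M` collects the geometric growth of both coefficient sequences, of `ω`, and of the kernel in
    -- `u`; each exponent is enlarged to `n.1 + n.2`.
    set M : ℝ := (|γ| + 1) * (|σ| + 1) * (|ω| + 1) * u ^ ρ with hM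
    have hM0 : 0 < M := by positivity
    refine Summable.of_nonneg_of_le (fun n => ?_) (fun n => ?_)
      ((summable_geometric_div_Gamma_prod hρ (add_pos hα hν) hM0).mul_left (u ^ (α + ν - 1)))
    · exact mul_nonneg (abs_nonneg _) (rlKernel_nonneg (by positivity) hu.le)
    · have hpos : 0 < Real.Gamma (ρ * (n.1 + n.2) + (α + ν)) :=
        Real.Gamma_pos_of_pos (by positivity)
      have h1 : |A n.1 * B n.2| ≤ ((|γ| + 1) * (|σ| + 1) * (|ω| + 1)) ^ (n.1 + n.2) := by
        simp only [hA, hB, abs_mul, abs_pow]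
        have e1 : |risingCoeff γ n.1| ≤ (|γ| + 1) ^ (n.1 + n.2) :=
          (abs_risingCoeff_le γ n.1).trans
            (pow_le_pow_right₀ (by simp) (Nat.le_add_right _ _))
        have e2 : |risingCoeff σ n.2| ≤ (|σ| + 1) ^ (n.1 + n.2) :=
          (abs_risingCoeff_le σ n.2).trans
            (pow_le_pow_right₀ (by simp) (Nat.le_add_left _ _))
        have e3 : |ω| ^ (n.1 + n.2) ≤ (|ω| + 1) ^ (n.1 + n.2) := by gcongr; linarith
        calc |risingCoeff γ n.1| * |ω| ^ n.1 * (|risingCoeff σ n.2| * |ω| ^ n.2)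
            = |risingCoeff γ n.1| * |risingCoeff σ n.2| * |ω| ^ (n.1 + n.2) := by ring
          _ ≤ (|γ| + 1) ^ (n.1 + n.2) * (|σ| + 1) ^ (n.1 + n.2) * (|ω| + 1) ^ (n.1 + n.2) := by
              gcongr
          _ = _ := by rw [mul_pow, mul_pow]
      have h2 : rlKernel (ρ * (n.1 + n.2) + (α + ν)) u =
          (u ^ ρ) ^ (n.1 + n.2) * u ^ (α + ν - 1) / Real.Gamma (ρ * (n.1 + n.2) + (α + ν)) := by
        rw [rlKernel, add_sub_assoc, Real.rpow_add hu, Real.rpow_mul hu.le]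
        norm_cast
      rw [h2]
      calc _ ≤ ((|γ| + 1) * (|σ| + 1) * (|ω| + 1)) ^ (n.1 + n.2) *
            ((u ^ ρ) ^ (n.1 + n.2) * u ^ (α + ν - 1) /
              Real.Gamma (ρ * (n.1 + n.2) + (α + ν))) := by gcongr
        _ = _ := by rw [hM, mul_pow _ (u ^ ρ)]; ring
  have hmain := hasSum_integral_of_summable_integral_norm hFint hFS
  have hint : ∫ v in Ioo 0 u, ∑' n, F n v =
      ∫ v in Ioo 0 u, mlKernel ρ α ω γ (u - v) * mlKernel ρ ν ω σ v := by
    refine setIntegral_congr_fun measurableSet_Ioo fun v hv => ?_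
    have h1 := hasSum_mlKernel hρ hα ω γ (sub_pos.2 hv.2)
    have h2 := hasSum_mlKernel hρ hν ω σ hv.1
    have h3 := h1.mul h2 (summable_mul_of_summable_norm h1.summable.norm h2.summable.norm)
    refine (h3.congr_fun fun n => ?_).tsum_eq
    simp only [hF, hA, hB]
    ring
  rw [hint] at hmain
  simp_rw [hFI] at hmain
  -- On the diagonal `n.1 + n.2 = n` the order `ρ n + (α + ν)` is constant, so only the coefficients
  -- are convolved.
  have hsig := (Finset.HasAntidiagonal.sigmaAntidiagonalEquivProd (A := ℕ)).hasSum_iff.2 hmain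
  have hfin := hsig.sigma fun n => hasSum_fintype _
  refine hfin.unique ((hasSum_mlKernel hρ (add_pos hα hν) ω (γ + σ) hu).congr_fun fun n => ?_)
  rw [← sum_antidiagonal_risingCoeff_mul, Finset.univ_eq_attach, Finset.sum_mul, Finset.sum_mul,
    ← Finset.sum_attach (Finset.HasAntidiagonal.antidiagonal n)]
  refine Finset.sum_congr rfl fun p _ => ?_
  have hp : p.1.1 + p.1.2 = n := Finset.HasAntidiagonal.mem_antidiagonal.1 p.2
  have hp' : (p.1.1 : ℝ) + p.1.2 = n := by exact_mod_cast hp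
  have hω : ω ^ n = ω ^ p.1.1 * ω ^ p.1.2 := by rw [← pow_add, hp]
  simp only [Function.comp, Finset.HasAntidiagonal.sigmaAntidiagonalEquivProd_apply, hA, hB, hp', hω]
  ring

lemma measurable_mlKernel {ρ α : ℝ} (hρ : 0 < ρ) (hα : 0 < α) (ω γ : ℝ) :
    Measurable (mlKernel ρ α ω γ) := by
  have := (continuous_mittagLeffler hρ hα γ).measurable
  unfold mlKernel
  fun_prop

lemma exists_abs_mlKernel_le {ρ α : ℝ} (hρ : 0 < ρ) (hα : 0 < α) (ω γ R : ℝ) :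
    ∃ C, 0 ≤ C ∧ ∀ u, 0 < u → u ≤ R → |mlKernel ρ α ω γ u| ≤ C * u ^ (α - 1) := by
  have hc : Continuous fun u : ℝ => mittagLeffler ρ α γ (ω * u ^ ρ) :=
    (continuous_mittagLeffler hρ hα γ).comp
      (continuous_const.mul (Real.continuous_rpow_const hρ.le))
  obtain ⟨C, hC⟩ := (isCompact_Icc (a := (0 : ℝ)) (b := R)).exists_bound_of_continuousOn
    hc.continuousOn
  refine ⟨max C 0, le_max_right _ _, fun u hu huR => ?_⟩
  rw [mlKernel, abs_mul, abs_of_pos (Real.rpow_pos_of_pos hu _), mul_comm]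
  gcongr
  exact (hC u ⟨hu.le, huR⟩).trans (le_max_left _ _)

/-- The Mittag-Leffler factor may vanish, so no purely multiplicative bound is possible. Near `0` it
exceeds half its value `1 / Γ(α)` at `0`; on `[δ, R]` the power is bounded, which the additive
constant absorbs. -/
lemma exists_rpow_le_mlKernel {ρ α : ℝ} (hρ : 0 < ρ) (hα : 0 < α) (ω γ R : ℝ) :
    ∃ C, 0 ≤ C ∧ ∀ u, 0 < u → u ≤ R → u ^ (α - 1) ≤ C * |mlKernel ρ α ω γ u| + C := by
  have hc : Continuous fun u : ℝ => mittagLeffler ρ α γ (ω * u ^ ρ) :=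
    (continuous_mittagLeffler hρ hα γ).comp
      (continuous_const.mul (Real.continuous_rpow_const hρ.le))
  have hG : 0 < Real.Gamma α := Real.Gamma_pos_of_pos hα
  have h0 : (2 * Real.Gamma α)⁻¹ < mittagLeffler ρ α γ (ω * (0 : ℝ) ^ ρ) := by
    rw [Real.zero_rpow hρ.ne', mul_zero, mittagLeffler_zero]
    gcongr
    linarith
  obtain ⟨δ, hδ, hδ'⟩ := Metric.eventually_nhds_iff.1
    (hc.continuousAt.eventually (lt_mem_nhds h0))
  have hcont : ContinuousOn (fun u : ℝ => u ^ (α - 1)) (Icc δ R) := fun u hu =>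
    (Real.continuousAt_rpow_const _ _ (.inl (hδ.trans_le hu.1).ne')).continuousWithinAt
  obtain ⟨C, hC⟩ := isCompact_Icc.exists_bound_of_continuousOn hcont
  refine ⟨max C (2 * Real.Gamma α), le_max_of_le_right (by positivity), fun u hu huR => ?_⟩
  have hup : 0 < u ^ (α - 1) := Real.rpow_pos_of_pos hu _
  have hmax : 0 ≤ max C (2 * Real.Gamma α) := le_max_of_le_right (by positivity)
  rcases lt_or_ge u δ with h | h
  · have h1 := hδ' (y := u) (by simpa [abs_of_pos hu] using h)
    have h2 : (2 * Real.Gamma α)⁻¹ ≤ |mittagLeffler ρ α γ (ω * u ^ ρ)| :=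
      h1.le.trans (le_abs_self _)
    rw [mlKernel, abs_mul, abs_of_pos hup]
    have h3 : u ^ (α - 1) ≤ (2 * Real.Gamma α) *
        (u ^ (α - 1) * |mittagLeffler ρ α γ (ω * u ^ ρ)|) := by
      rw [mul_left_comm]
      refine le_mul_of_one_le_right hup.le ?_
      calc (1 : ℝ) = 2 * Real.Gamma α * (2 * Real.Gamma α)⁻¹ := by field_simp
        _ ≤ _ := by gcongr
    refine h3.trans ((mul_le_mul_of_nonneg_right (le_max_right C _) (by positivity)).trans ?_)
    linarith
  · have h1 := (le_abs_self _).trans (hC u ⟨h, huR⟩)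
    have h2 : 0 ≤ max C (2 * Real.Gamma α) * |mlKernel ρ α ω γ u| := by positivity
    have h3 := le_max_left C (2 * Real.Gamma α)
    linarith

/-! ### Change of variables by `ψ`. -/

/-- `D` is an interval with right end point `x` (not in `D`) on which `ψ` is a change of variables
with positive derivative, up to `x`, and of increment at most `R`. -/
structure IsSubstitution (ψ : ℝ → ℝ) (D : Set ℝ) (x R : ℝ) : Prop where
  measurableSet : MeasurableSet D
  lt_right : ∀ s ∈ D, s < x
  Ioo_subset : ∀ s ∈ D, Ioo s x ⊆ D
  continuousOn : ContinuousOn ψ (insert x D)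
  strictMonoOn : StrictMonoOn ψ (insert x D)
  hasDerivAt : ∀ t ∈ D, HasDerivAt ψ (deriv ψ t) t
  deriv_pos : ∀ t ∈ D, 0 < deriv ψ t
  sub_le : ∀ s ∈ D, ψ x - ψ s ≤ R

namespace IsSubstitution

variable {ψ : ℝ → ℝ} {D : Set ℝ} {x R : ℝ}

lemma sub_pos (h : IsSubstitution ψ D x R) {s : ℝ} (hs : s ∈ D) : 0 < ψ x - ψ s :=
  _root_.sub_pos.2 (h.strictMonoOn (mem_insert_of_mem _ hs) (mem_insert _ _) (h.lt_right s hs))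

lemma Ioi_inter (h : IsSubstitution ψ D x R) {s : ℝ} (hs : s ∈ D) : Ioi s ∩ D = Ioo s x := by
  ext t
  exact ⟨fun ht => ⟨ht.1, h.lt_right t ht.2⟩, fun ht => ⟨ht.1, h.Ioo_subset s hs ht⟩⟩

lemma image_Ioo (h : IsSubstitution ψ D x R) {s : ℝ} (hs : s ∈ D) :
    (fun t => ψ t - ψ s) '' Ioo s x = Ioo 0 (ψ x - ψ s) := by
  have hsub : Icc s x ⊆ insert x D := by
    intro t ht
    rcases eq_or_lt_of_le ht.2 with h1 | h1
    · exact .inl h1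
    rcases eq_or_lt_of_le ht.1 with h2 | h2
    · exact .inr (h2 ▸ hs)
    · exact .inr (h.Ioo_subset s hs ⟨h2, h1⟩)
  have hsx := h.lt_right s hs
  refine Subset.antisymm ?_ ?_
  · rintro _ ⟨t, ht, rfl⟩
    have ht' := hsub ⟨ht.1.le, ht.2.le⟩
    have h1 := h.strictMonoOn (mem_insert_of_mem _ hs) ht' ht.1
    have h2 := h.strictMonoOn ht' (mem_insert _ _) ht.2
    constructor <;> simp only <;> linarith
  · have hc : ContinuousOn (fun t => ψ t - ψ s) (Icc s x) :=
      (h.continuousOn.mono hsub).sub continuousOn_const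
    simpa using intermediate_value_Ioo hsx.le hc

lemma monotoneOn_sub (h : IsSubstitution ψ D x R) {s : ℝ} (hs : s ∈ D) :
    MonotoneOn (fun t => ψ t - ψ s) (Ioo s x) := fun _ ha _ hb hab =>
  sub_le_sub_right (h.strictMonoOn.monotoneOn (mem_insert_of_mem _ (h.Ioo_subset s hs ha))
    (mem_insert_of_mem _ (h.Ioo_subset s hs hb)) hab) _

lemma integrableOn_comp_iff (h : IsSubstitution ψ D x R) {s : ℝ} (hs : s ∈ D) (g : ℝ → ℝ) :
    IntegrableOn (fun t => deriv ψ t * g (ψ t - ψ s)) (Ioo s x) ↔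
      IntegrableOn g (Ioo 0 (ψ x - ψ s)) := by
  rw [← h.image_Ioo hs, integrableOn_image_iff_integrableOn_deriv_smul_of_monotoneOn
    measurableSet_Ioo (fun t ht => ((h.hasDerivAt t (h.Ioo_subset s hs ht)).sub_const
      (ψ s)).hasDerivWithinAt) (h.monotoneOn_sub hs)]
  rfl

lemma integral_comp (h : IsSubstitution ψ D x R) {s : ℝ} (hs : s ∈ D) (g : ℝ → ℝ) :
    ∫ t in Ioo s x, deriv ψ t * g (ψ t - ψ s) = ∫ v in Ioo 0 (ψ x - ψ s), g v := by
  rw [← h.image_Ioo hs, integral_image_eq_integral_deriv_smul_of_monotoneOn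
    measurableSet_Ioo (fun t ht => ((h.hasDerivAt t (h.Ioo_subset s hs ht)).sub_const
      (ψ s)).hasDerivWithinAt) (h.monotoneOn_sub hs)]
  rfl

lemma aemeasurable (h : IsSubstitution ψ D x R) : AEMeasurable ψ (volume.restrict D) :=
  (h.continuousOn.mono (subset_insert _ _)).aemeasurable h.measurableSet

end IsSubstitution

/-! ### Fubini for the composition. -/

/-- The integrand of the composition of two kernel operators in the variable `ψ`. -/
noncomputable def compIntegrand (k₁ k₂ ψ w : ℝ → ℝ) (x : ℝ) (p : ℝ × ℝ) : ℝ :=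
  deriv ψ p.1 * k₁ (ψ x - ψ p.1) * (Iio p.1).indicator (fun s => k₂ (ψ p.1 - ψ s) * w s) p.2

section compIntegrand

variable {k₁ k₂ k₃ ψ w : ℝ → ℝ} {D : Set ℝ} {x R p q C₁ C₂ : ℝ}

lemma aestronglyMeasurable_compIntegrand (h : IsSubstitution ψ D x R)
    (hk₁ : Measurable k₁) (hk₂ : Measurable k₂)
    (hw : AEStronglyMeasurable w (volume.restrict D)) :
    AEStronglyMeasurable (compIntegrand k₁ k₂ ψ w x)
      ((volume.restrict D).prod (volume.restrict D)) := by
  have e : compIntegrand k₁ k₂ ψ w x = {p : ℝ × ℝ | p.2 < p.1}.indicator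
      (fun p => deriv ψ p.1 * k₁ (ψ x - ψ p.1) * (k₂ (ψ p.1 - ψ p.2) * w p.2)) := by
    funext p
    by_cases hp : p.2 < p.1 <;> simp [compIntegrand, hp]
  rw [e]
  have h1 := h.aemeasurable.comp_fst (ν := volume.restrict D)
  have h2 := h.aemeasurable.comp_snd (μ := volume.restrict D)
  have h3 := hw.aemeasurable.comp_snd (μ := volume.restrict D)
  refine AEStronglyMeasurable.indicator ?_ (measurableSet_lt measurable_snd measurable_fst)
  refine AEMeasurable.aestronglyMeasurable ?_
  exact (((measurable_deriv ψ).comp measurable_fst).aemeasurable.mul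
    (hk₁.comp_aemeasurable (aemeasurable_const.sub h1))).mul
      ((hk₂.comp_aemeasurable (h1.sub h2)).mul h3)

/-- Writing `ψ x - ψ t = (ψ x - ψ s) - (ψ t - ψ s)` makes the integral over `t` a convolution in `v
= ψ t - ψ s`. -/
lemma compIntegrand_eq_indicator (s : ℝ) :
    (fun t => compIntegrand k₁ k₂ ψ w x (t, s)) = (Ioi s).indicator fun t =>
      w s * (deriv ψ t * (k₁ ((ψ x - ψ s) - (ψ t - ψ s)) * k₂ (ψ t - ψ s))) := by
  funext t
  by_cases ht : s < t
  · simp only [compIntegrand, indicator, mem_Iio, mem_Ioi, ht, if_true, sub_sub_sub_cancel_right]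
    ring
  · simp [compIntegrand, ht]

lemma integrable_compIntegrand_left (h : IsSubstitution ψ D x R) {s : ℝ} (hs : s ∈ D)
    (hk : IntegrableOn (fun v => k₁ ((ψ x - ψ s) - v) * k₂ v) (Ioo 0 (ψ x - ψ s))) :
    Integrable (fun t => compIntegrand k₁ k₂ ψ w x (t, s)) (volume.restrict D) := by
  rw [compIntegrand_eq_indicator, integrable_indicator_iff measurableSet_Ioi, IntegrableOn,
    Measure.restrict_restrict measurableSet_Ioi, h.Ioi_inter hs]
  exact ((h.integrableOn_comp_iff hs _).2 hk).const_mul _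

lemma integral_compIntegrand_left (h : IsSubstitution ψ D x R) {s : ℝ} (hs : s ∈ D) :
    ∫ t in D, compIntegrand k₁ k₂ ψ w x (t, s) =
      w s * ∫ v in Ioo 0 (ψ x - ψ s), k₁ ((ψ x - ψ s) - v) * k₂ v := by
  rw [compIntegrand_eq_indicator, integral_indicator measurableSet_Ioi,
    Measure.restrict_restrict measurableSet_Ioi, h.Ioi_inter hs, integral_const_mul]
  congr 1
  exact h.integral_comp hs fun v => k₁ ((ψ x - ψ s) - v) * k₂ v

/-- As `ψ' > 0`, the norm of the integrand is the integrand built from `|k₁|`, `|k₂|`, `|w|`. -/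
lemma integral_norm_compIntegrand_left (h : IsSubstitution ψ D x R) {s : ℝ} (hs : s ∈ D) :
    ∫ t in D, ‖compIntegrand k₁ k₂ ψ w x (t, s)‖ =
      |w s| * ∫ v in Ioo 0 (ψ x - ψ s), |k₁ ((ψ x - ψ s) - v)| * |k₂ v| := by
  rw [← integral_compIntegrand_left (k₁ := fun u => |k₁ u|) (k₂ := fun u => |k₂ u|)
    (w := fun u => |w u|) h hs]
  refine setIntegral_congr_fun h.measurableSet fun t ht => ?_
  have h0 := h.deriv_pos t ht
  by_cases hst : s < t <;> simp [compIntegrand, hst, abs_of_pos h0]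

/-- Tonelli, integrating over `t` first: the power bounds turn the inner integral into a beta
integral, a constant times `(ψ x - ψ s) ^ (p + q - 1)`, which `hint` controls. -/
lemma integrable_compIntegrand (h : IsSubstitution ψ D x R)
    (hk₁ : Measurable k₁) (hk₂ : Measurable k₂)
    (hw : AEStronglyMeasurable w (volume.restrict D)) (hp : 0 < p) (hq : 0 < q)
    (hb₁ : ∀ u, 0 < u → u ≤ R → |k₁ u| ≤ C₁ * u ^ (p - 1))
    (hb₂ : ∀ u, 0 < u → u ≤ R → |k₂ u| ≤ C₂ * u ^ (q - 1))
    (hint : Integrable (fun s => (ψ x - ψ s) ^ (p + q - 1) * w s) (volume.restrict D)) :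
    Integrable (compIntegrand k₁ k₂ ψ w x)
      ((volume.restrict D).prod (volume.restrict D)) := by
  have hm := aestronglyMeasurable_compIntegrand h hk₁ hk₂ hw
  have hle {s v : ℝ} (hs : s ∈ D) (hv : v ∈ Ioo 0 (ψ x - ψ s)) :
      |k₁ ((ψ x - ψ s) - v)| * |k₂ v| ≤
        C₁ * C₂ * (((ψ x - ψ s) - v) ^ (p - 1) * v ^ (q - 1)) := by
    have hR := h.sub_le s hs
    have h1 := hb₁ ((ψ x - ψ s) - v) (by linarith [hv.2]) (by linarith [hv.1])
    have h2 := hb₂ v hv.1 (by linarith [hv.2])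
    calc _ ≤ (C₁ * ((ψ x - ψ s) - v) ^ (p - 1)) * (C₂ * v ^ (q - 1)) :=
          mul_le_mul h1 h2 (abs_nonneg _) ((abs_nonneg _).trans h1)
      _ = _ := by ring
  have hkint {s : ℝ} (hs : s ∈ D) :
      IntegrableOn (fun v => |k₁ ((ψ x - ψ s) - v)| * |k₂ v|) (Ioo 0 (ψ x - ψ s)) := by
    refine Integrable.mono' ((integrableOn_and_integral_rpow_mul_rpow hp hq
      (h.sub_pos hs)).1.const_mul (C₁ * C₂)) ?_ ?_
    · exact (by fun_prop : Measurable fun v => |k₁ ((ψ x - ψ s) - v)| * |k₂ v|).aestronglyMeasurable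
    · refine (ae_restrict_iff' measurableSet_Ioo).2 (.of_forall fun v hv => ?_)
      rw [Real.norm_of_nonneg (by positivity)]
      exact hle hs hv
  refine (integrable_prod_iff' hm).2 ⟨?_, ?_⟩
  · refine (ae_restrict_iff' h.measurableSet).2 (.of_forall fun s hs => ?_)
    refine integrable_compIntegrand_left h hs ((hkint hs).mono' ?_ (.of_forall fun v => ?_))
    · exact (by fun_prop : Measurable fun v => k₁ ((ψ x - ψ s) - v) * k₂ v).aestronglyMeasurable
    · rw [Real.norm_eq_abs, abs_mul]
  · refine Integrable.mono' (hint.norm.const_mul (C₁ * C₂ *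
      (Real.Gamma p * Real.Gamma q / Real.Gamma (p + q)))) hm.norm.prod_swap.integral_prod_right' ?_
    refine (ae_restrict_iff' h.measurableSet).2 (.of_forall fun s hs => ?_)
    rw [Real.norm_of_nonneg (integral_nonneg fun t => norm_nonneg _),
      integral_norm_compIntegrand_left h hs]
    have hU := h.sub_pos hs
    obtain ⟨h1, h2⟩ := integrableOn_and_integral_rpow_mul_rpow hp hq hU
    calc _ ≤ |w s| * ∫ v in Ioo 0 (ψ x - ψ s),
          C₁ * C₂ * (((ψ x - ψ s) - v) ^ (p - 1) * v ^ (q - 1)) := by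
          refine mul_le_mul_of_nonneg_left ?_ (abs_nonneg _)
          exact setIntegral_mono_on (hkint hs) (h1.const_mul _) measurableSet_Ioo
            fun v hv => hle hs hv
      _ = _ := by
          rw [integral_const_mul, h2, Real.norm_eq_abs, abs_mul,
            abs_of_pos (Real.rpow_pos_of_pos hU _)]
          ring

/-- Convolution of the kernels composes the operators. -/
lemma integrable_and_integral_comp (h : IsSubstitution ψ D x R)
    (hF : Integrable (compIntegrand k₁ k₂ ψ w x) ((volume.restrict D).prod (volume.restrict D)))
    (hk : ∀ u, 0 < u → ∫ v in Ioo 0 u, k₁ (u - v) * k₂ v = k₃ u) :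
    IntegrableOn (fun t => deriv ψ t * k₁ (ψ x - ψ t) *
        ∫ s in Iio t ∩ D, k₂ (ψ t - ψ s) * w s) D ∧
      ∫ t in D, deriv ψ t * k₁ (ψ x - ψ t) * ∫ s in Iio t ∩ D, k₂ (ψ t - ψ s) * w s =
        ∫ s in D, k₃ (ψ x - ψ s) * w s := by
  have e (t : ℝ) : ∫ s in D, compIntegrand k₁ k₂ ψ w x (t, s) =
      deriv ψ t * k₁ (ψ x - ψ t) * ∫ s in Iio t ∩ D, k₂ (ψ t - ψ s) * w s := by
    simp only [compIntegrand]
    rw [integral_const_mul, integral_indicator measurableSet_Iio,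
      Measure.restrict_restrict measurableSet_Iio]
  simp_rw [← e]
  refine ⟨hF.integral_prod_left, ?_⟩
  rw [integral_integral_swap (f := fun t s => compIntegrand k₁ k₂ ψ w x (t, s)) hF]
  refine setIntegral_congr_fun h.measurableSet fun s hs => ?_
  rw [integral_compIntegrand_left h hs, hk _ (h.sub_pos hs), mul_comm]

/-- With outer kernel `1`, almost every slice at fixed `t` is `ψ'(t) ≠ 0` times the integrand of the
inner operator, so Fubini yields its convergence. -/
lemma ae_integrableOn_of_compIntegrand (h : IsSubstitution ψ D x R)
    (hF : Integrable (compIntegrand (fun _ => 1) k₂ ψ w x)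
      ((volume.restrict D).prod (volume.restrict D))) :
    ∀ᵐ t ∂(volume.restrict D), IntegrableOn (fun s => k₂ (ψ t - ψ s) * w s) (Iio t ∩ D) := by
  filter_upwards [hF.prod_right_ae, ae_restrict_mem h.measurableSet] with t ht htD
  have h0 := (h.deriv_pos t htD).ne'
  simp only [compIntegrand, mul_one] at ht
  rwa [integrable_const_mul_iff (IsUnit.mk0 _ h0), integrable_indicator_iff measurableSet_Iio,
    IntegrableOn, Measure.restrict_restrict measurableSet_Iio] at ht

end compIntegrand

/-! ### Intervals with possibly infinite end points. -/

/-- The open real interval `(a, x)` with possibly infinite left end point. -/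
def leftOpenInterval (a : EReal) (x : ℝ) : Set ℝ := {t : ℝ | a < (t : EReal) ∧ t < x}

lemma isOpen_leftOpenInterval (a : EReal) (x : ℝ) : IsOpen (leftOpenInterval a x) :=
  (isOpen_Ioi.preimage continuous_coe_real_ereal).inter isOpen_Iio

lemma closedInterval_ae_eq (a : EReal) (x : ℝ) :
    closedInterval a (x : EReal) =ᵐ[volume] leftOpenInterval a x := by
  -- For infinite `a`, `a.toReal` is the default `0`; discarding one more point is harmless.
  have hfin : ({a.toReal, x} : Set ℝ).Finite := by simp
  refine eventuallyEq_set.2 ?_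
  filter_upwards [measure_eq_zero_iff_ae_notMem.1 (hfin.measure_zero volume)] with t ht
  simp only [mem_insert_iff, mem_singleton_iff, not_or] at ht
  refine ⟨fun h => ⟨lt_of_le_of_ne h.1 ?_, lt_of_le_of_ne (EReal.coe_le_coe_iff.1 h.2) ht.2⟩,
    fun h => ⟨h.1.le, EReal.coe_le_coe_iff.2 h.2.le⟩⟩
  rintro rfl
  exact ht.1 (EReal.toReal_coe t).symm

lemma Iio_inter_leftOpenInterval {a : EReal} {x t : ℝ} (ht : t ∈ leftOpenInterval a x) :
    Iio t ∩ leftOpenInterval a x = leftOpenInterval a t := by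
  ext s
  exact ⟨fun h => ⟨h.2.1, h.1⟩, fun h => ⟨h.2, h.1, lt_trans h.2 ht.2⟩⟩

lemma leftIntegrand_eq (ρ α ω γ : ℝ) (ψ f : ℝ → ℝ) (x t : ℝ) :
    leftIntegrand ρ α ω γ ψ f x t =
      deriv ψ t * mlKernel ρ α ω γ (ψ x - ψ t) * f t := by
  simp only [leftIntegrand, mlKernel]
  ring

lemma leftIntegrand_eq' (ρ α ω γ : ℝ) (ψ f : ℝ → ℝ) (x t : ℝ) :
    leftIntegrand ρ α ω γ ψ f x t =
      mlKernel ρ α ω γ (ψ x - ψ t) * (deriv ψ t * f t) := by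
  rw [leftIntegrand_eq]
  ring

lemma leftConverges_iff {ρ α ω γ : ℝ} {ψ f : ℝ → ℝ} {a : EReal} {x : ℝ} :
    LeftConverges ρ α ω γ ψ a f x ↔
      IntegrableOn (leftIntegrand ρ α ω γ ψ f x) (leftOpenInterval a x) :=
  integrableOn_congr_set_ae (closedInterval_ae_eq a x)

lemma leftOp_eq (ρ α ω γ : ℝ) (ψ f : ℝ → ℝ) (a : EReal) (x : ℝ) :
    leftOp ρ α ω γ ψ a f x = ∫ t in leftOpenInterval a x, leftIntegrand ρ α ω γ ψ f x t :=
  setIntegral_congr_set (closedInterval_ae_eq a x)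

lemma ordConnected_closedInterval (a b : EReal) : (closedInterval a b).OrdConnected :=
  ⟨fun _ hx _ hy _ hz => ⟨hx.1.trans (EReal.coe_le_coe_iff.2 hz.1),
    (EReal.coe_le_coe_iff.2 hz.2).trans hy.2⟩⟩

lemma leftOpenInterval_subset_interior {a b : EReal} {x : ℝ} (hx : x ∈ closedInterval a b) :
    leftOpenInterval a x ⊆ interior (closedInterval a b) :=
  interior_maximal (fun _ ht => ⟨ht.1.le, (EReal.coe_le_coe_iff.2 ht.2.le).trans hx.2⟩)
    (isOpen_leftOpenInterval a x)

lemma isSubstitution_leftOpenInterval {a b : EReal} {ψ : ℝ → ℝ}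
    (hψ_mono : MonotoneOn ψ (closedInterval a b))
    (hψ_diff : DifferentiableOn ℝ ψ (closedInterval a b))
    (hψ_ne : ∀ x ∈ closedInterval a b, derivWithin ψ (closedInterval a b) x ≠ 0)
    {B : ℝ} (hB : ∀ t ∈ closedInterval a b, B ≤ ψ t) {x : ℝ} (hx : x ∈ closedInterval a b) :
    IsSubstitution ψ (leftOpenInterval a x) x (ψ x - B) := by
  -- In the interior `derivWithin` is `deriv`; it is nonnegative by monotonicity and nonzero by
  -- hypothesis.
  have hpos : ∀ t ∈ interior (closedInterval a b), 0 < deriv ψ t := fun t ht => by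
    have hne := hψ_ne t (interior_subset ht)
    have h0 := hψ_mono.derivWithin_nonneg (x := t)
    rw [derivWithin_of_mem_nhds (mem_interior_iff_mem_nhds.1 ht)] at hne h0
    exact lt_of_le_of_ne h0 hne.symm
  have hsub := leftOpenInterval_subset_interior hx
  have hsub' : insert x (leftOpenInterval a x) ⊆ closedInterval a b :=
    insert_subset hx (hsub.trans interior_subset)
  refine ⟨(isOpen_leftOpenInterval a x).measurableSet, fun s hs => hs.2,
    fun s hs t ht => ⟨hs.1.trans (EReal.coe_lt_coe_iff.2 ht.1), ht.2⟩,
    hψ_diff.continuousOn.mono hsub', ?_, fun t ht => ?_, fun t ht => hpos t (hsub ht),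
    fun s hs => ?_⟩
  · exact (strictMonoOn_of_deriv_pos (ordConnected_closedInterval a b).convex
      hψ_diff.continuousOn hpos).mono hsub'
  · exact (hψ_diff.differentiableAt (mem_interior_iff_mem_nhds.1 (hsub ht))).hasDerivAt
  · linarith [hB s (interior_subset (hsub hs))]

/-- The exceptional null set must not depend on the right end point. Every point strictly inside
lies to the left of some rational in the interval, so countably many null sets suffice. -/
lemma ae_mem_closedInterval_of_rat {a b : EReal} {P : ℝ → Prop}
    (h : ∀ q : ℚ, (q : ℝ) ∈ closedInterval a b →
      ∀ᵐ t ∂(volume.restrict (leftOpenInterval a q)), P t) :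
    ∀ᵐ x ∂(volume : Measure ℝ), x ∈ closedInterval a b → P x := by
  have h' : ∀ᵐ t : ℝ, ∀ q : ℚ, (q : ℝ) ∈ closedInterval a b → t ∈ leftOpenInterval a q → P t :=
    ae_all_iff.2 fun q => by
      by_cases hq : (q : ℝ) ∈ closedInterval a b
      · filter_upwards [(ae_restrict_iff' (isOpen_leftOpenInterval a q).measurableSet).1 (h q hq)]
          with t ht _ using ht
      · exact .of_forall fun t hq' => absurd hq' hq
  have hfin : ({a.toReal, b.toReal} : Set ℝ).Finite := by simp
  filter_upwards [h', measure_eq_zero_iff_ae_notMem.1 (hfin.measure_zero volume)] with t ht hne hmem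
  simp only [mem_insert_iff, mem_singleton_iff, not_or] at hne
  have h1 : a < (t : EReal) := lt_of_le_of_ne hmem.1 fun e => hne.1 (by rw [e, EReal.toReal_coe])
  have h2 : (t : EReal) < b := lt_of_le_of_ne hmem.2 fun e => hne.2 (by rw [← e, EReal.toReal_coe])
  obtain ⟨q, hq1, hq2⟩ := EReal.exists_rat_btwn_of_lt h2
  exact ht q ⟨(h1.trans hq1).le, hq2.le⟩ ⟨h1, EReal.coe_lt_coe_iff.1 hq1⟩

/-! ### The left-sided operators. -/

section leftSided

variable {α γ ν ρ σ ω : ℝ} {a b : EReal} {ψ f : ℝ → ℝ} {x R : ℝ}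

lemma ae_leftConverges (hα : 0 < α) (hρ : 0 < ρ) (ω γ : ℝ)
    (hψ : ∀ x ∈ closedInterval a b, ∃ R, IsSubstitution ψ (leftOpenInterval a x) x R)
    (hf : ∀ x ∈ closedInterval a b,
      IntegrableOn (fun t => deriv ψ t * f t) (leftOpenInterval a x)) :
    ∀ᵐ x ∂(volume : Measure ℝ), x ∈ closedInterval a b → LeftConverges ρ α ω γ ψ a f x := by
  refine ae_mem_closedInterval_of_rat fun q hq => ?_
  obtain ⟨R, h⟩ := hψ q hq
  obtain ⟨C, -, hb⟩ := exists_abs_mlKernel_le hρ hα ω γ R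
  -- With `k₁ = 1` and `p = 1` the required weight is `(ψ q - ψ s) ^ α`, which is bounded by `R ^
  -- α`, so integrability of `ψ' f` is enough.
  have hF := integrable_compIntegrand (k₁ := fun _ => 1) (p := 1) h measurable_const
    (measurable_mlKernel hρ hα ω γ) (hf q hq).1 (C₁ := 1) one_pos hα (by simp) hb ?_
  · filter_upwards [ae_integrableOn_of_compIntegrand h hF, ae_restrict_mem h.measurableSet]
      with t ht htD
    rw [Iio_inter_leftOpenInterval htD] at ht
    rw [leftConverges_iff]
    exact ht.congr (.of_forall fun s => (leftIntegrand_eq' _ _ _ _ _ _ _ _).symm)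
  · refine (hf q hq).bdd_mul (c := R ^ (1 + α - 1)) ?_ ?_
    · exact ((aemeasurable_const.sub h.aemeasurable).pow_const _).aestronglyMeasurable
    · refine (ae_restrict_iff' h.measurableSet).2 (.of_forall fun s hs => ?_)
      have h1 := h.sub_pos hs
      rw [Real.norm_of_nonneg (by positivity)]
      exact Real.rpow_le_rpow h1.le (h.sub_le s hs) (by linarith)

/-- Convergence for the actual kernel yields convergence for the power that dominates it in Fubini;
integrability of `ψ' f` pays for the additive constant. -/
lemma integrable_rpow_of_leftConverges (hα : 0 < α) (hρ : 0 < ρ)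
    (h : IsSubstitution ψ (leftOpenInterval a x) x R)
    (hf : IntegrableOn (fun t => deriv ψ t * f t) (leftOpenInterval a x))
    (hc : LeftConverges ρ α ω γ ψ a f x) :
    IntegrableOn (fun s => (ψ x - ψ s) ^ (α - 1) * (deriv ψ s * f s)) (leftOpenInterval a x) := by
  obtain ⟨C, hC, hb⟩ := exists_rpow_le_mlKernel hρ hα ω γ R
  have hc' := leftConverges_iff.1 hc
  refine Integrable.mono' ((hc'.norm.const_mul C).add (hf.norm.const_mul C)) ?_ ?_
  · exact ((aemeasurable_const.sub h.aemeasurable).pow_const _).aestronglyMeasurable.mul hf.1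
  · refine (ae_restrict_iff' h.measurableSet).2 (.of_forall fun s hs => ?_)
    have h1 := h.sub_pos hs
    have h2 := hb _ h1 (h.sub_le s hs)
    rw [Pi.add_apply, leftIntegrand_eq', norm_mul, norm_mul (mlKernel ρ α ω γ _), Real.norm_of_nonneg (by positivity),
      Real.norm_eq_abs (mlKernel ρ α ω γ _), ← mul_assoc, ← add_mul]
    gcongr

/-- Convergence of the inner operator is not needed as a hypothesis: Fubini on the product handles
the null set where it diverges. -/
lemma leftConverges_and_leftOp_leftOp (hα : 0 < α) (hν : 0 < ν) (hρ : 0 < ρ)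
    (h : IsSubstitution ψ (leftOpenInterval a x) x R)
    (hf : IntegrableOn (fun t => deriv ψ t * f t) (leftOpenInterval a x))
    (hc : LeftConverges ρ (α + ν) ω (γ + σ) ψ a f x) :
    LeftConverges ρ α ω γ ψ a (leftOp ρ ν ω σ ψ a f) x ∧
      leftOp ρ α ω γ ψ a (leftOp ρ ν ω σ ψ a f) x = leftOp ρ (α + ν) ω (γ + σ) ψ a f x := by
  obtain ⟨C₁, -, hb₁⟩ := exists_abs_mlKernel_le hρ hα ω γ R
  obtain ⟨C₂, -, hb₂⟩ := exists_abs_mlKernel_le hρ hν ω σ R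
  have hF := integrable_compIntegrand h (measurable_mlKernel hρ hα ω γ)
    (measurable_mlKernel hρ hν ω σ) hf.1 hα hν hb₁ hb₂
    (integrable_rpow_of_leftConverges (add_pos hα hν) hρ h hf hc)
  obtain ⟨h1, h2⟩ := integrable_and_integral_comp h hF fun u hu =>
    integral_mlKernel_mul hρ hα hν ω γ σ hu
  have e : EqOn (fun t => deriv ψ t * mlKernel ρ α ω γ (ψ x - ψ t) *
      ∫ s in Iio t ∩ leftOpenInterval a x, mlKernel ρ ν ω σ (ψ t - ψ s) * (deriv ψ s * f s))
      (leftIntegrand ρ α ω γ ψ (leftOp ρ ν ω σ ψ a f) x) (leftOpenInterval a x) := fun t ht => by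
    simp only [leftIntegrand_eq ρ α, leftOp_eq, Iio_inter_leftOpenInterval ht,
      leftIntegrand_eq' ρ ν]
  refine ⟨leftConverges_iff.2 (h1.congr_fun e h.measurableSet), ?_⟩
  rw [leftOp_eq, ← setIntegral_congr_fun h.measurableSet e, h2, leftOp_eq]
  simp only [leftIntegrand_eq']

end leftSided

/-- The semigroup property of the left-sided operators. -/
lemma left_semigroup
    {α γ ν ρ σ ω : ℝ} (hα : 0 < α) (hν : 0 < ν) (hρ : 0 < ρ)
    {a b : EReal} {ψ : ℝ → ℝ}
    (hψ_mono : MonotoneOn ψ (closedInterval a b))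
    (hψ_diff : DifferentiableOn ℝ ψ (closedInterval a b))
    (hψ_ne : ∀ x ∈ closedInterval a b, derivWithin ψ (closedInterval a b) x ≠ 0)
    {f : ℝ → ℝ} (hbdd : BddBelow (ψ '' closedInterval a b))
    (hf : ∀ x ∈ closedInterval a b,
      IntegrableOn (fun t => deriv ψ t * f t) (closedInterval a (x : EReal)) volume) :
    (∀ᵐ x ∂(volume : Measure ℝ), x ∈ closedInterval a b →
        LeftConverges ρ α ω γ ψ a f x ∧
        LeftConverges ρ ν ω σ ψ a f x ∧
        LeftConverges ρ (α + ν) ω (γ + σ) ψ a f x) ∧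
      (∀ x ∈ closedInterval a b, LeftConverges ρ (α + ν) ω (γ + σ) ψ a f x →
        LeftConverges ρ α ω γ ψ a (leftOp ρ ν ω σ ψ a f) x ∧
        LeftConverges ρ ν ω σ ψ a (leftOp ρ α ω γ ψ a f) x ∧
        leftOp ρ α ω γ ψ a (leftOp ρ ν ω σ ψ a f) x = leftOp ρ (α + ν) ω (γ + σ) ψ a f x ∧
        leftOp ρ (α + ν) ω (γ + σ) ψ a f x =
          leftOp ρ ν ω σ ψ a (leftOp ρ α ω γ ψ a f) x) := by
  obtain ⟨B, hB⟩ := hbdd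
  have hψ (x : ℝ) (hx : x ∈ closedInterval a b) :=
    isSubstitution_leftOpenInterval hψ_mono hψ_diff hψ_ne
      (fun t ht => hB (mem_image_of_mem ψ ht)) hx
  have hf' (x : ℝ) (hx : x ∈ closedInterval a b) :
      IntegrableOn (fun t => deriv ψ t * f t) (leftOpenInterval a x) :=
    (hf x hx).congr_set_ae (closedInterval_ae_eq a x).symm
  have hψ' (x : ℝ) (hx : x ∈ closedInterval a b) :
      ∃ R, IsSubstitution ψ (leftOpenInterval a x) x R := ⟨_, hψ x hx⟩
  refine ⟨?_, fun x hx hc => ?_⟩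
  · filter_upwards [ae_leftConverges hα hρ ω γ hψ' hf', ae_leftConverges hν hρ ω σ hψ' hf',
      ae_leftConverges (add_pos hα hν) hρ ω (γ + σ) hψ' hf'] with x h1 h2 h3 hx
    exact ⟨h1 hx, h2 hx, h3 hx⟩
  · obtain ⟨h1, h2⟩ := leftConverges_and_leftOp_leftOp hα hν hρ (hψ x hx) (hf' x hx) hc
    -- The other order of composition: `(α, γ)` and `(ν, σ)` are exchanged, and the target is
    -- symmetric in them.
    obtain ⟨h3, h4⟩ := leftConverges_and_leftOp_leftOp (σ := γ) (γ := σ) hν hα hρ (hψ x hx)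
      (hf' x hx) (by rwa [add_comm ν, add_comm σ])
    rw [add_comm ν, add_comm σ] at h4
    exact ⟨h1, h3, h2, h4.symm⟩

/-! ### Reflection to the right-sided operators. -/

section reflection

variable {ρ α ω γ : ℝ} {ψ f : ℝ → ℝ} {b : EReal} {x : ℝ}

lemma neg_mem_closedInterval_iff {a b : EReal} {t : ℝ} :
    -t ∈ closedInterval a b ↔ t ∈ closedInterval (-b) (-a) := by
  simp only [closedInterval, mem_ofPred_eq, EReal.coe_neg]
  rw [EReal.le_neg, EReal.neg_le, and_comm]

lemma neg_preimage_closedInterval (a b : EReal) :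
    (fun t : ℝ => -t) ⁻¹' closedInterval a b = closedInterval (-b) (-a) :=
  ext fun _ => neg_mem_closedInterval_iff

lemma integrableOn_closedInterval_comp_neg {a b : EReal} {g : ℝ → ℝ} :
    IntegrableOn (fun t => g (-t)) (closedInterval (-b) (-a)) ↔
      IntegrableOn g (closedInterval a b) := by
  rw [← neg_preimage_closedInterval]
  exact (Measure.measurePreserving_neg volume).integrableOn_comp_preimage
    (Homeomorph.neg ℝ).measurableEmbedding

lemma integral_closedInterval_comp_neg (a b : EReal) (g : ℝ → ℝ) :
    ∫ t in closedInterval (-b) (-a), g (-t) = ∫ t in closedInterval a b, g t := by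
  rw [← neg_preimage_closedInterval]
  exact (Measure.measurePreserving_neg volume).setIntegral_preimage_emb
    (Homeomorph.neg ℝ).measurableEmbedding g _

lemma deriv_neg_comp_neg (ψ : ℝ → ℝ) (t : ℝ) : deriv (fun t => -ψ (-t)) t = deriv ψ (-t) := by
  rw [deriv.fun_neg, deriv_comp_neg, neg_neg]

/-- The two signs in `-ψ(-t)` cancel in the derivative and reverse the difference of values of `ψ`.
-/
lemma leftIntegrand_reflect (ρ α ω γ : ℝ) (ψ f : ℝ → ℝ) (x t : ℝ) :
    leftIntegrand ρ α ω γ (fun t => -ψ (-t)) (fun t => f (-t)) x t =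
      rightIntegrand ρ α ω γ ψ f (-x) (-t) := by
  simp only [leftIntegrand, rightIntegrand, deriv_neg_comp_neg, sub_neg_eq_add, neg_add_eq_sub]

lemma leftConverges_reflect :
    LeftConverges ρ α ω γ (fun t => -ψ (-t)) (-b) (fun t => f (-t)) x ↔
      RightConverges ρ α ω γ ψ b f (-x) := by
  rw [LeftConverges, RightConverges, EReal.coe_neg,
    ← integrableOn_closedInterval_comp_neg (g := rightIntegrand ρ α ω γ ψ f (-x)), neg_neg,
    funext (leftIntegrand_reflect ρ α ω γ ψ f x)]

lemma leftOp_reflect (ρ α ω γ : ℝ) (ψ f : ℝ → ℝ) (b : EReal) (x : ℝ) :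
    leftOp ρ α ω γ (fun t => -ψ (-t)) (-b) (fun t => f (-t)) x =
      rightOp ρ α ω γ ψ b f (-x) := by
  rw [leftOp, rightOp, EReal.coe_neg,
    ← integral_closedInterval_comp_neg _ _ (rightIntegrand ρ α ω γ ψ f (-x)), neg_neg,
    funext (leftIntegrand_reflect ρ α ω γ ψ f x)]

end reflection

theorem theorem4
    (α γ ν ρ σ ω : ℝ) (hα : 0 < α) (hν : 0 < ν) (hρ : 0 < ρ)
    (a b : EReal) (hab : a < b)
    (ψ : ℝ → ℝ)
    (hψ_mono : MonotoneOn ψ (closedInterval a b))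
    (hψ_diff : DifferentiableOn ℝ ψ (closedInterval a b))
    (hψ_ne : ∀ x ∈ closedInterval a b, derivWithin ψ (closedInterval a b) x ≠ 0)
    (f : ℝ → ℝ) :
    -- the left-sided operators
    (BddBelow (ψ '' closedInterval a b) →
      (∀ x ∈ closedInterval a b,
        IntegrableOn (fun t => deriv ψ t * f t) (closedInterval a (x : EReal)) volume) →
      (∀ᵐ x ∂(volume : Measure ℝ), x ∈ closedInterval a b →
        LeftConverges ρ α ω γ ψ a f x ∧
        LeftConverges ρ ν ω σ ψ a f x ∧
        LeftConverges ρ (α + ν) ω (γ + σ) ψ a f x) ∧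
      (∀ x ∈ closedInterval a b, LeftConverges ρ (α + ν) ω (γ + σ) ψ a f x →
        LeftConverges ρ α ω γ ψ a (leftOp ρ ν ω σ ψ a f) x ∧
        LeftConverges ρ ν ω σ ψ a (leftOp ρ α ω γ ψ a f) x ∧
        leftOp ρ α ω γ ψ a (leftOp ρ ν ω σ ψ a f) x = leftOp ρ (α + ν) ω (γ + σ) ψ a f x ∧
        leftOp ρ (α + ν) ω (γ + σ) ψ a f x = leftOp ρ ν ω σ ψ a (leftOp ρ α ω γ ψ a f) x)) ∧
    -- the right-sided operators
    (BddAbove (ψ '' closedInterval a b) →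
      (∀ x ∈ closedInterval a b,
        IntegrableOn (fun t => deriv ψ t * f t) (closedInterval (x : EReal) b) volume) →
      (∀ᵐ x ∂(volume : Measure ℝ), x ∈ closedInterval a b →
        RightConverges ρ α ω γ ψ b f x ∧
        RightConverges ρ ν ω σ ψ b f x ∧
        RightConverges ρ (α + ν) ω (γ + σ) ψ b f x) ∧
      (∀ x ∈ closedInterval a b, RightConverges ρ (α + ν) ω (γ + σ) ψ b f x →
        RightConverges ρ α ω γ ψ b (rightOp ρ ν ω σ ψ b f) x ∧
        RightConverges ρ ν ω σ ψ b (rightOp ρ α ω γ ψ b f) x ∧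
        rightOp ρ α ω γ ψ b (rightOp ρ ν ω σ ψ b f) x = rightOp ρ (α + ν) ω (γ + σ) ψ b f x ∧
        rightOp ρ (α + ν) ω (γ + σ) ψ b f x = rightOp ρ ν ω σ ψ b (rightOp ρ α ω γ ψ b f) x)) := by
  refine ⟨left_semigroup hα hν hρ hψ_mono hψ_diff hψ_ne, fun hbdd hf => ?_⟩
  have hmono : MonotoneOn (fun t => -ψ (-t)) (closedInterval (-b) (-a)) := fun s hs t ht hst =>
    neg_le_neg (hψ_mono (neg_mem_closedInterval_iff.2 ht) (neg_mem_closedInterval_iff.2 hs)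
      (neg_le_neg hst))
  have hderiv (t : ℝ) (ht : t ∈ closedInterval (-b) (-a)) :
      HasDerivWithinAt (fun t => -ψ (-t)) (derivWithin ψ (closedInterval a b) (-t))
        (closedInterval (-b) (-a)) t := by
    have h1 := (hψ_diff (-t) (neg_mem_closedInterval_iff.2 ht)).hasDerivWithinAt
    have h2 := (h1.comp t (hasDerivAt_neg t).hasDerivWithinAt
      fun s hs => neg_mem_closedInterval_iff.2 hs).neg
    convert! h2 using 1
    simp
  have hdiff : DifferentiableOn ℝ (fun t => -ψ (-t)) (closedInterval (-b) (-a)) := fun t ht =>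
    (hderiv t ht).differentiableWithinAt
  have hne : ∀ t ∈ closedInterval (-b) (-a),
      derivWithin (fun t => -ψ (-t)) (closedInterval (-b) (-a)) t ≠ 0 := fun t ht => by
    -- Here `a < b` enters: the interval has nonempty interior, so the one-sided derivative at an
    -- end point is unique.
    have hu : UniqueDiffWithinAt ℝ (closedInterval (-b) (-a)) t := by
      refine uniqueDiffWithinAt_convex (ordConnected_closedInterval _ _).convex ?_ (subset_closure ht)
      obtain ⟨c, hc1, hc2⟩ := EReal.exists_rat_btwn_of_lt (EReal.neg_lt_neg_iff.2 hab)
      refine ⟨c, mem_interior_iff_mem_nhds.2 ?_⟩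
      filter_upwards [(isOpen_Ioo.preimage continuous_coe_real_ereal).mem_nhds ⟨hc1, hc2⟩]
        with s hs using ⟨hs.1.le, hs.2.le⟩
    rw [(hderiv t ht).derivWithin hu]
    exact hψ_ne _ (neg_mem_closedInterval_iff.2 ht)
  have hbdd' : BddBelow ((fun t => -ψ (-t)) '' closedInterval (-b) (-a)) := by
    obtain ⟨B, hB⟩ := hbdd
    refine ⟨-B, ?_⟩
    rintro _ ⟨t, ht, rfl⟩
    exact neg_le_neg (hB (mem_image_of_mem ψ (neg_mem_closedInterval_iff.2 ht)))
  have hf' : ∀ x ∈ closedInterval (-b) (-a),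
      IntegrableOn (fun t => deriv (fun t => -ψ (-t)) t * f (-t))
        (closedInterval (-b) (x : EReal)) volume := fun x hx => by
    have h1 := integrableOn_closedInterval_comp_neg.2 (hf (-x) (neg_mem_closedInterval_iff.2 hx))
    simpa only [EReal.coe_neg, neg_neg, deriv_neg_comp_neg] using h1
  have hop (ρ α ω γ : ℝ) : leftOp ρ α ω γ (fun t => -ψ (-t)) (-b) (fun t => f (-t)) =
      fun x => rightOp ρ α ω γ ψ b f (-x) := funext (leftOp_reflect ρ α ω γ ψ f b)
  obtain ⟨h1, h2⟩ := left_semigroup (γ := γ) (σ := σ) (ω := ω) hα hν hρ hmono hdiff hne hbdd' hf'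
  simp only [hop, leftConverges_reflect, leftOp_reflect] at h1 h2
  constructor
  -- Negation preserves null sets, so the almost everywhere statement is pulled back along it.
  · have h3 := (Measure.measurePreserving_neg (volume : Measure ℝ)).quasiMeasurePreserving.ae h1
    filter_upwards [h3] with x hx hmem
    rw [neg_neg] at hx
    exact hx (neg_mem_closedInterval_iff.1 (by rwa [neg_neg]))
  · intro x hx hc
    have h3 := h2 (-x) (neg_mem_closedInterval_iff.1 (by rwa [neg_neg]))
    rw [neg_neg] at h3
    exact h3 hc
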